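/- Let $p_1,p_2,r$ be positive integers with $p_1/p_2+p_2/p_1<r\le p:=p_1p_2$. For $A=(A_1,\dots,A_r)\in(\mathbb{R}^{p_1\times p_2})^r$ put $\varphi(A)=[\mathrm{vec}(A_1),\dots,\mathrm{vec}(A_r)]\in\mathbb{R}^{p\times r}$, where $\mathrm{vec}$ stacks columns, $A_R=\sum_i A_iA_i^\top$ and $A_C=\sum_i A_i^\top A_i$. Call $A$ canonically decomposable if there are $P\in GL_{p_1}$, $Q\in GL_{p_2}$ and integers $1\le a\le p_1-1$, $1\le b\le p_2-1$ such that every $PA_iQ^{-1}$ is block diagonal with diagonal blocks of sizes $a\times b$ and $(p_1-a)\times(p_2-b)$. Let $\mathcal{H}$ be the set of all $A$ that are not canonically decomposable and satisfy $\mathrm{rank}(\varphi(A))=\min\{p,r\}$, $\mathrm{rank}(A_R)=p_1$ and $\mathrm{rank}(A_C)=p_2$. Put $$\mathcal{D}_{p_1,p_2,r}=\left\{A\in\mathcal{H}:\ \left(\tfrac{A_R}{\mathrm{tr}(A_R)},\tfrac{A_C}{\mathrm{tr}(A_R)},\mathrm{tr}(A_R)\right)=\left(\tfrac{1}{p_1}I_{p_1},\tfrac{1}{p_2}I_{p_2},p\right)\right\},$$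 $$\mathcal{C}_{p_1,p_2,r}=\varphi(\mathcal{D}_{p_1,p_2,r})\subset\mathbb{R}^{p\times r},\qquad \mathcal{C}^+_{p_1,p_2,r}=\{XX^\top: X\in\mathcal{C}_{p_1,p_2,r}\}\subset\mathbb{R}^{p\times p}.$$ With $a=[\mathrm{vec}(A_1)^\top,\dots,\mathrm{vec}(A_r)^\top]^\top$ and with $K_{q,q}$ the commutation matrix, $K_{q,q}\mathrm{vec}(B^\top)=\mathrm{vec}(B)$ for $B\in\mathbb{R}^{q\times q}$, put $$J(A)=\begin{bmatrix}\frac1p(I_{p_1^2}+K_{p_1,p_1})[A_1\otimes I_{p_1},\dots,A_r\otimes I_{p_1}]-\frac{2}{p_1^2p_2}\mathrm{vec}(I_{p_1})a^\top\\ \frac1p(I_{p_2^2}+K_{p_2,p_2})[I_{p_2}\otimes A_1^\top,\dots,I_{p_2}\otimes A_r^\top]-\frac{2}{p_1p_2^2}\mathrm{vec}(I_{p_2})a^\top\\ 2a^\top\end{bmatrix}.$$ Let $N(M)$ denote the null space of a matrix $M$. For a set $S$ of real matrices of a given size and $X\in S$, the tangent space $T_XS$ is the set of the velocities $\gamma'(0)$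 of the smooth curves $\gamma:(-\varepsilon,\varepsilon)\to S$, $\varepsilon>0$, with $\gamma(0)=X$ (the usual tangent space when $S$ is an embedded submanifold). Then for every $A\in\mathcal{D}_{p_1,p_2,r}$, with $\tilde A=\varphi(A)$, $$T_{\tilde A}\,\mathcal{C}_{p_1,p_2,r}=\{B\in\mathbb{R}^{p\times r}:\ \mathrm{vec}(B)\in N(J(A))\},$$ $$T_{\tilde A\tilde A^\top}\,\mathcal{C}^+_{p_1,p_2,r}=\{\tilde AB^\top+B\tilde A^\top:\ B\in T_{\tilde A}\,\mathcal{C}_{p_1,p_2,r}\}.$$ -/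

import Mathlib

open scoped Matrix Kronecker ContDiff

namespace CoreCov

/-- The tangent space at `X` of an embedded smooth submanifold `S` of the Euclidean space of real
matrices: the set of the velocities `γ'(0)` of the smooth curves `γ : (-ε, ε) → S`, `γ(0) = X`.
Smoothness and derivatives of matrix-valued curves are entrywise. -/
def tangentSpaceAt {m n : Type*} (S : Set (Matrix m n ℝ)) (X : Matrix m n ℝ) :
    Set (Matrix m n ℝ) :=
  {B | ∃ ε : ℝ, 0 < ε ∧ ∃ γ : ℝ → Matrix m n ℝ,
    (∀ j k, ContDiffOn ℝ ∞ (fun t => γ t j k) (Set.Ioo (-ε) ε)) ∧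
    (∀ t ∈ Set.Ioo (-ε) ε, γ t ∈ S) ∧
    γ 0 = X ∧
    ∀ j k, HasDerivAt (fun t => γ t j k) (B j k) 0}

variable {p₁ p₂ r : ℕ}

/-- The map `φ(A₁, …, A_r) = [vec A₁, …, vec A_r]`.  Here `Matrix.vec` stacks columns, and the index
set of `ℝ^p`, `p = p₁ p₂`, is `Fin p₂ × Fin p₁` (column index first), as for Mathlib's Kronecker
product. -/
def vecCols (A : Fin r → Matrix (Fin p₁) (Fin p₂) ℝ) :
    Matrix (Fin p₂ × Fin p₁) (Fin r) ℝ :=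
  Matrix.of fun s i => Matrix.vec (A i) s

/-- `A_R = ∑ᵢ Aᵢ Aᵢᵀ`. -/
def rowGram (A : Fin r → Matrix (Fin p₁) (Fin p₂) ℝ) : Matrix (Fin p₁) (Fin p₁) ℝ :=
  ∑ i, A i * (A i)ᵀ

/-- `A_C = ∑ᵢ Aᵢᵀ Aᵢ`. -/
def colGram (A : Fin r → Matrix (Fin p₁) (Fin p₂) ℝ) : Matrix (Fin p₂) (Fin p₂) ℝ :=
  ∑ i, (A i)ᵀ * A i

/-- `A` is canonically decomposable: there are `P ∈ GL_{p₁}`, `Q ∈ GL_{p₂}` and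
`1 ≤ a ≤ p₁ - 1`, `1 ≤ b ≤ p₂ - 1` such that every `P Aᵢ Q⁻¹` is block diagonal with diagonal blocks
of sizes `a × b` and `(p₁ - a) × (p₂ - b)`. -/
def CanonicallyDecomposable (A : Fin r → Matrix (Fin p₁) (Fin p₂) ℝ) : Prop :=
  ∃ (P : GL (Fin p₁) ℝ) (Q : GL (Fin p₂) ℝ) (a b : ℕ),
    1 ≤ a ∧ a < p₁ ∧ 1 ≤ b ∧ b < p₂ ∧
    ∀ i j k, ((j.val < a ∧ b ≤ k.val) ∨ (a ≤ j.val ∧ k.val < b)) →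
      ((P : Matrix (Fin p₁) (Fin p₁) ℝ) * A i *
        ((Q⁻¹ : GL (Fin p₂) ℝ) : Matrix (Fin p₂) (Fin p₂) ℝ)) j k = 0

/-- The set `H_{p₁,p₂,r}` with the canonically decomposable tuples removed. -/
def setH (p₁ p₂ r : ℕ) : Set (Fin r → Matrix (Fin p₁) (Fin p₂) ℝ) :=
  {A | (vecCols A).rank = min (p₁ * p₂) r ∧ (rowGram A).rank = p₁ ∧ (colGram A).rank = p₂ ∧
    ¬ CanonicallyDecomposable A}

/-- The map `F(A) = (A_R / tr A_R, A_C / tr A_R, tr A_R)`. -/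
noncomputable def mapF (A : Fin r → Matrix (Fin p₁) (Fin p₂) ℝ) :
    Matrix (Fin p₁) (Fin p₁) ℝ × Matrix (Fin p₂) (Fin p₂) ℝ × ℝ :=
  ((rowGram A).trace⁻¹ • rowGram A, (rowGram A).trace⁻¹ • colGram A, (rowGram A).trace)

/-- The level set `D_{p₁,p₂,r} = F⁻¹{(I/p₁, I/p₂, p)}` in `H_{p₁,p₂,r}`. -/
def setD (p₁ p₂ r : ℕ) : Set (Fin r → Matrix (Fin p₁) (Fin p₂) ℝ) :=
  {A | A ∈ setH p₁ p₂ r ∧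
    mapF A = ((p₁ : ℝ)⁻¹ • 1, (p₂ : ℝ)⁻¹ • 1, (p₁ : ℝ) * (p₂ : ℝ))}

/-- `C_{p₁,p₂,r} = φ(D_{p₁,p₂,r})`. -/
def setC (p₁ p₂ r : ℕ) : Set (Matrix (Fin p₂ × Fin p₁) (Fin r) ℝ) :=
  vecCols '' setD p₁ p₂ r

/-- `C⁺_{p₁,p₂,r}`, the image of `C_{p₁,p₂,r}` under `X ↦ X Xᵀ`. -/
def setCPlus (p₁ p₂ r : ℕ) : Set (Matrix (Fin p₂ × Fin p₁) (Fin p₂ × Fin p₁) ℝ) :=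
  (fun X => X * Xᵀ) '' setC p₁ p₂ r

/-- The commutation matrix `K_{m,n}`, characterized by `K_{m,n} vec(Bᵀ) = vec(B)` for
`B ∈ ℝ^{m × n}`. -/
def commutation (m n : ℕ) : Matrix (Fin n × Fin m) (Fin m × Fin n) ℝ :=
  Matrix.of fun s t => if s = t.swap then 1 else 0

theorem commutation_mulVec_vec {m n : ℕ} (B : Matrix (Fin m) (Fin n) ℝ) :
    commutation m n *ᵥ Matrix.vec Bᵀ = Matrix.vec B := by
  ext ⟨j, i⟩
  rw [Matrix.mulVec, dotProduct, Finset.sum_eq_single (i, j)]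
  · simp [commutation, Matrix.vec]
  · rintro ⟨i', j'⟩ - h
    simp only [commutation, Matrix.of_apply, Prod.swap_prod_mk, Prod.mk.injEq, ite_mul, one_mul,
      zero_mul, ite_eq_right_iff]
    rintro ⟨rfl, rfl⟩
    exact absurd rfl h
  · simp

/-- `a = [vec(A₁)ᵀ, …, vec(A_r)ᵀ]ᵀ`. -/
def stackVec (A : Fin r → Matrix (Fin p₁) (Fin p₂) ℝ) : Fin r × (Fin p₂ × Fin p₁) → ℝ :=
  fun x => Matrix.vec (A x.1) x.2

/-- The block row `[M₁, …, M_r]`. -/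
def blockRow {m n : Type*} (M : Fin r → Matrix m n ℝ) : Matrix m (Fin r × n) ℝ :=
  Matrix.of fun s x => M x.1 s x.2

/-- `J₁(A) = (1/p) (I + K_{p₁,p₁}) [A₁ ⊗ I, …, A_r ⊗ I] - (2/(p₁² p₂)) vec(I) aᵀ`. -/
noncomputable def J₁ (A : Fin r → Matrix (Fin p₁) (Fin p₂) ℝ) :
    Matrix (Fin p₁ × Fin p₁) (Fin r × (Fin p₂ × Fin p₁)) ℝ :=
  (1 / ((p₁ : ℝ) * p₂)) • ((1 + commutation p₁ p₁) *
      blockRow fun i => A i ⊗ₖ (1 : Matrix (Fin p₁) (Fin p₁) ℝ)) -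
    (2 / ((p₁ : ℝ) ^ 2 * p₂)) •
      Matrix.vecMulVec (Matrix.vec (1 : Matrix (Fin p₁) (Fin p₁) ℝ)) (stackVec A)

/-- `J₂(A) = (1/p) (I + K_{p₂,p₂}) [I ⊗ A₁ᵀ, …, I ⊗ A_rᵀ] - (2/(p₁ p₂²)) vec(I) aᵀ`. -/
noncomputable def J₂ (A : Fin r → Matrix (Fin p₁) (Fin p₂) ℝ) :
    Matrix (Fin p₂ × Fin p₂) (Fin r × (Fin p₂ × Fin p₁)) ℝ :=
  (1 / ((p₁ : ℝ) * p₂)) • ((1 + commutation p₂ p₂) *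
      blockRow fun i => (1 : Matrix (Fin p₂) (Fin p₂) ℝ) ⊗ₖ (A i)ᵀ) -
    (2 / ((p₁ : ℝ) * (p₂ : ℝ) ^ 2)) •
      Matrix.vecMulVec (Matrix.vec (1 : Matrix (Fin p₂) (Fin p₂) ℝ)) (stackVec A)

/-- `J₃(A) = 2 aᵀ`. -/
def J₃ (A : Fin r → Matrix (Fin p₁) (Fin p₂) ℝ) :
    Matrix Unit (Fin r × (Fin p₂ × Fin p₁)) ℝ :=
  Matrix.of fun _ x => 2 * stackVec A x

/-- The matrix `J(A)` with the block rows `J₁(A)`, `J₂(A)`, `J₃(A)`. -/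
noncomputable def J (A : Fin r → Matrix (Fin p₁) (Fin p₂) ℝ) :
    Matrix ((Fin p₁ × Fin p₁) ⊕ ((Fin p₂ × Fin p₂) ⊕ Unit)) (Fin r × (Fin p₂ × Fin p₁)) ℝ :=
  Matrix.fromRows (J₁ A) (Matrix.fromRows (J₂ A) (J₃ A))

end CoreCov

/-! On `setD` the defining equations say `A_R = p₂ I` and `A_C = p₁ I`; full rank and
indecomposability turn out to be open conditions on this level set. The derivative of `(A_R, A_C)`
at `A` in direction `B` is `gramPolar A B`, and its kernel is the null space of `J(A)`. So a tangent
vector lies in `N(J(A))`, and the converse requires a curve with prescribed velocity.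

The curve comes from the implicit function theorem once `gramPolar A` is onto the pairs of symmetric
matrices with equal traces. Its adjoint is, up to a factor, `(S₁, S₂) ↦ (S₁ Aᵢ + Aᵢ S₂)ᵢ`, and a
kernel element would split `A` along eigenspaces (`eq_smul_one_of_not_canonicallyDecomposable`).
Conversely, when the Gram matrices are scalar, injectivity of this adjoint excludes a decomposition
(`not_canonicallyDecomposable_of_intertwiners`); injectivity is open, so the curve stays in `setD`.

For `C⁺` no smooth lift of a curve to `C` is needed. A velocity `W` at `X Xᵀ` is symmetric, and its
quadratic form vanishes on `ker Xᵀ`, because there the nonnegative form along the curve attains its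
minimum `0`. Linear algebra then gives `W = X Bᵀ + B Xᵀ`, and the constant partial traces along the
curve put `B` in the kernel. -/

open Filter Topology

open Matrix

/-! ### Curves in level sets of submersions -/

/-- A curve in a level set with a prescribed velocity, at a point where the derivative is onto. -/
theorem exists_contDiffAt_curve_levelSet {E F : Type*} [NormedAddCommGroup E] [NormedSpace ℝ E]
    [NormedAddCommGroup F] [NormedSpace ℝ F] [FiniteDimensional ℝ E] [FiniteDimensional ℝ F]
    {G : E → F} (hG : ContDiff ℝ ω G) {x : E} {G' : E →L[ℝ] F} (hG' : HasFDerivAt G G' x)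
    (hsurj : Function.Surjective G') {v : E} (hv : G' v = 0) :
    ∃ γ : ℝ → E, ContDiffAt ℝ ω γ 0 ∧ γ 0 = x ∧ HasDerivAt γ v 0 ∧ ∀ᶠ t in 𝓝 0, G (γ t) = G x := by
  have : CompleteSpace E := FiniteDimensional.complete ℝ E
  have : CompleteSpace F := FiniteDimensional.complete ℝ F
  obtain ⟨K₀, hK₀⟩ := LinearMap.exists_rightInverse_of_surjective (G' : E →ₗ[ℝ] F)
    (LinearMap.range_eq_top.2 hsurj)
  set K : F →L[ℝ] E := K₀.toContinuousLinearMap with hK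
  have hGK : ∀ y, G' (K y) = y := fun y => by
    exact LinearMap.congr_fun hK₀ y
  let ℓ : ℝ × F →L[ℝ] E :=
    (ContinuousLinearMap.fst ℝ ℝ F).smulRight v + K.comp (ContinuousLinearMap.snd ℝ ℝ F)
  have hℓ : ∀ y, ℓ y = y.1 • v + K y.2 := fun y => by simp [ℓ]
  -- On the slice `x + t v + K s`, with `K` a right inverse of `G'`, the derivative of `Φ` at `0` is
  -- the identity because `G' v = 0`. The curve is the image of `t ↦ Φ⁻¹(t, 0)`.
  let Φ : ℝ × F → ℝ × F := fun y => (y.1, G (x + ℓ y) - G x)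
  have hΦ : ContDiffAt ℝ ω Φ 0 := by
    have : ContDiff ℝ ω Φ :=
      contDiff_fst.prodMk ((hG.comp (contDiff_const.add ℓ.contDiff)).sub contDiff_const)
    exact this.contDiffAt
  have hΦ0 : Φ 0 = 0 := by simp [Φ]
  have hder : HasFDerivAt Φ ((ContinuousLinearEquiv.refl ℝ (ℝ × F) : ℝ × F →L[ℝ] ℝ × F)) 0 := by
    have h1 : HasFDerivAt (fun y => x + ℓ y) ℓ 0 := ℓ.hasFDerivAt.const_add x
    have h2 : HasFDerivAt G G' (x + ℓ 0) := by simpa using hG'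
    have h3 := (hasFDerivAt_fst (𝕜 := ℝ) (p := (0 : ℝ × F))).prodMk
      ((h2.comp (0 : ℝ × F) h1).sub_const (G x))
    refine h3.congr_fderiv ?_
    refine ContinuousLinearMap.ext fun y => ?_
    simp [hℓ, hv, hGK]
  have hω : (ω : WithTop ℕ∞) ≠ 0 := by simp
  let g := hΦ.localInverse hder hω
  have hg : ContDiffAt ℝ ω g 0 := by simpa [hΦ0] using hΦ.to_localInverse hder hω
  have hst := hΦ.hasStrictFDerivAt' hder hω
  have hg0 : g 0 = 0 := by
    have := hΦ.localInverse_apply_image hder hω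
    rwa [hΦ0] at this
  have hright : ∀ᶠ y in 𝓝 (0 : ℝ × F), Φ (g y) = y := by
    have := hst.eventually_right_inverse
    rwa [hΦ0] at this
  have hgd : HasFDerivAt g
      ((ContinuousLinearEquiv.refl ℝ (ℝ × F)).symm : ℝ × F →L[ℝ] ℝ × F) 0 := by
    have := hst.to_localInverse.hasFDerivAt
    rwa [hΦ0] at this
  have hline : HasDerivAt (fun t : ℝ => ((t, 0) : ℝ × F)) (1, 0) 0 :=
    (hasDerivAt_id (0 : ℝ)).prodMk (hasDerivAt_const _ _)
  have hline0 : Tendsto (fun t : ℝ => ((t, 0) : ℝ × F)) (𝓝 0) (𝓝 0) := hline.continuousAt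
  refine ⟨fun t => x + ℓ (g (t, 0)), ?_, ?_, ?_, ?_⟩
  · refine contDiffAt_const.add (ℓ.contDiff.contDiffAt.comp (0 : ℝ) ?_)
    exact ContDiffAt.comp (0 : ℝ) (g := g) hg (contDiff_id.prodMk contDiff_const).contDiffAt
  · change x + ℓ (g 0) = x
    simp [hg0]
  · have h1 : HasDerivAt (fun t : ℝ => g (t, 0)) (1, 0) 0 := by
      exact HasFDerivAt.comp_hasDerivAt (0 : ℝ) (l := g) hgd hline
    have h2 := (ℓ.hasFDerivAt.comp_hasDerivAt (0 : ℝ) h1).const_add x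
    simpa [hℓ] using h2
  · filter_upwards [hline0.eventually hright] with t ht
    have := congrArg Prod.snd ht
    exact sub_eq_zero.1 this

/-! ### Intertwiners and canonical decomposability -/

/-- An intertwiner of two real matrices `N₁`, `N₂` with all members of a family of matrices whose
Gram sums are scalar also intertwines the transposes. -/
theorem transpose_mul_eq_of_mul_eq {ι m n : Type*} [Fintype ι] [Fintype m] [Fintype n]
    [DecidableEq m] [DecidableEq n] {A : ι → Matrix m n ℝ} {c d : ℝ}
    (hR : ∑ i, A i * (A i)ᵀ = c • 1) (hC : ∑ i, (A i)ᵀ * A i = d • 1)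
    {N₁ : Matrix m m ℝ} {N₂ : Matrix n n ℝ} (h : ∀ i, N₁ * A i = A i * N₂) (i : ι) :
    N₁ᵀ * A i = A i * N₂ᵀ := by
  have hR' (X Y : Matrix m m ℝ) : ∑ i, (X * A i * (A i)ᵀ * Y).trace = c * (X * Y).trace := by
    simp_rw [Matrix.mul_assoc X, ← trace_sum, ← Finset.mul_sum, ← Finset.sum_mul, hR]
    simp
  have hC' (X Y : Matrix n n ℝ) : ∑ i, (X * (A i)ᵀ * A i * Y).trace = d * (X * Y).trace := by
    simp_rw [Matrix.mul_assoc X, ← trace_sum, ← Finset.mul_sum, ← Finset.sum_mul, hC]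
    simp
  -- Both sides are `∑ ‖N₁ Aᵢ‖² = ∑ ‖Aᵢ N₂‖²` in Frobenius norm. Expanding `∑ ‖N₁ᵀ Aᵢ - Aᵢ N₂ᵀ‖²`
  -- then gives `c ‖N₁‖² - 2 c ‖N₁‖² + d ‖N₂‖² = 0`.
  have hcd : c * (N₁ * N₁ᵀ).trace = d * (N₂ᵀ * N₂).trace := by
    rw [← hR', ← hC']
    refine Finset.sum_congr rfl fun i _ => ?_
    have : (A i)ᵀ * N₁ᵀ = N₂ᵀ * (A i)ᵀ := by simpa using congrArg transpose (h i)
    rw [h i, Matrix.mul_assoc, this, trace_mul_comm, ← Matrix.mul_assoc]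
  set D : ι → Matrix m n ℝ := fun i => N₁ᵀ * A i - A i * N₂ᵀ with hD
  have hsum : ∑ i, (D i * (D i)ᵀ).trace = 0 := by
    have key (i) : (D i * (D i)ᵀ).trace = (N₁ᵀ * A i * (A i)ᵀ * N₁).trace
        - 2 * (N₁ᵀ * N₁ * A i * (A i)ᵀ * 1).trace + (N₂ * (A i)ᵀ * A i * N₂ᵀ).trace := by
      have e1 : (N₁ᵀ * A i * (A i * N₂ᵀ)ᵀ).trace = (N₁ᵀ * N₁ * A i * (A i)ᵀ * 1).trace := by
        rw [transpose_mul, transpose_transpose, Matrix.mul_one, Matrix.mul_assoc N₁ᵀ N₁, h i]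
        simp only [Matrix.mul_assoc]
      have e2 : (A i * N₂ᵀ * (N₁ᵀ * A i)ᵀ).trace = (N₁ᵀ * A i * (A i * N₂ᵀ)ᵀ).trace := by
        rw [← trace_transpose, transpose_mul, transpose_transpose]
      have e3 : (A i * N₂ᵀ * (A i * N₂ᵀ)ᵀ).trace = (N₂ * (A i)ᵀ * A i * N₂ᵀ).trace := by
        rw [trace_mul_comm, transpose_mul, transpose_transpose]
        simp only [Matrix.mul_assoc]
      simp only [hD, transpose_sub, Matrix.sub_mul, Matrix.mul_sub, trace_sub]
      rw [e2, e1, e3, transpose_mul, transpose_transpose, ← Matrix.mul_assoc]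
      ring
    simp_rw [key, Finset.sum_add_distrib, Finset.sum_sub_distrib, ← Finset.mul_sum]
    rw [hR', hR', hC', trace_mul_comm N₁ᵀ, Matrix.mul_one, trace_mul_comm N₁ᵀ,
      trace_mul_comm N₂]
    linarith
  have hnn (i) : 0 ≤ (D i * (D i)ᵀ).trace := by
    simpa using (posSemidef_self_mul_conjTranspose (D i)).trace_nonneg
  have h0 : (D i * (D i)ᴴ).trace = 0 := by
    simpa using (Finset.sum_eq_zero_iff_of_nonneg fun i _ => hnn i).1 hsum i (Finset.mem_univ i)
  exact sub_eq_zero.1 (trace_mul_conjTranspose_self_eq_zero_iff.1 h0)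

/-- A real symmetric matrix is diagonal in a suitable basis. -/
theorem Matrix.IsSymm.exists_conj_eq_diagonal {n : Type*} [Fintype n] [DecidableEq n]
    {S : Matrix n n ℝ} (hS : S.IsSymm) :
    ∃ (U : GL n ℝ) (d : n → ℝ),
      (U : Matrix n n ℝ) * S * ((U⁻¹ : GL n ℝ) : Matrix n n ℝ) = diagonal d := by
  have hH : S.IsHermitian := by
    rw [IsHermitian, conjTranspose_eq_transpose_of_trivial]
    exact hS
  refine ⟨Unitary.toUnits (star hH.eigenvectorUnitary), hH.eigenvalues, ?_⟩
  have := hH.conjStarAlgAut_star_eigenvectorUnitary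
  rw [Unitary.conjStarAlgAut_apply] at this
  exact this

/-- A predicate on `Fin n` that is neither empty nor full becomes an initial segment after a
permutation. -/
theorem exists_perm_iff_val_lt {n : ℕ} (u : Fin n → Prop) (h₁ : ∃ j, u j) (h₀ : ∃ j, ¬ u j) :
    ∃ (a : ℕ) (σ : Equiv.Perm (Fin n)), 1 ≤ a ∧ a < n ∧ ∀ j, u (σ j) ↔ j.val < a := by
  classical
  have ha : Fintype.card {j // u j} < n := by
    obtain ⟨j, hj⟩ := h₀
    simpa using Fintype.card_subtype_lt hj
  have ha1 : 1 ≤ Fintype.card {j // u j} := by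
    obtain ⟨j, hj⟩ := h₁
    exact Fintype.card_pos_iff.2 ⟨⟨j, hj⟩⟩
  have e : {j : Fin n // j.val < Fintype.card {j // u j}} ≃ {j // u j} := by
    refine Fintype.equivOfCardEq ?_
    rw [Fintype.card_subtype, Fin.card_filter_val_lt, min_eq_right ha.le]
  refine ⟨_, e.extendSubtype, ha1, ha, fun j => ⟨fun h => ?_, fun h => e.extendSubtype_mem j h⟩⟩
  by_contra hj
  exact e.extendSubtype_not_mem j hj h

/-- The matrix obtained from an invertible matrix by permuting its rows. -/
noncomputable def Matrix.GeneralLinearGroup.permRows {n : Type*} [Fintype n] [DecidableEq n]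
    (P : GL n ℝ) (σ : Equiv.Perm n) : GL n ℝ where
  val := (P : Matrix n n ℝ).submatrix σ id
  inv := ((P⁻¹ : GL n ℝ) : Matrix n n ℝ).submatrix id σ
  val_inv := by
    rw [← submatrix_mul _ _ _ _ _ Function.bijective_id, ← Units.val_mul]
    simp
  inv_val := by
    rw [← submatrix_mul _ _ _ _ _ σ.bijective, ← Units.val_mul]
    simp

namespace CoreCov

variable {p₁ p₂ r : ℕ}

/-- `P` and `Q` can absorb permutations, so the blocks may sit on arbitrary nonempty proper index
sets. -/
theorem canonicallyDecomposable_of_blocks {A : Fin r → Matrix (Fin p₁) (Fin p₂) ℝ}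
    (P : GL (Fin p₁) ℝ) (Q : GL (Fin p₂) ℝ) (u : Fin p₁ → Prop) (w : Fin p₂ → Prop)
    (hu : ∃ j, u j) (hu' : ∃ j, ¬ u j) (hw : ∃ k, w k) (hw' : ∃ k, ¬ w k)
    (h : ∀ i j k, ((P : Matrix (Fin p₁) (Fin p₁) ℝ) * A i *
        ((Q⁻¹ : GL (Fin p₂) ℝ) : Matrix (Fin p₂) (Fin p₂) ℝ)) j k ≠ 0 → (u j ↔ w k)) :
    CanonicallyDecomposable A := by
  obtain ⟨a, σ, ha1, ha, hσ⟩ := exists_perm_iff_val_lt u hu hu'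
  obtain ⟨b, τ, hb1, hb, hτ⟩ := exists_perm_iff_val_lt w hw hw'
  refine ⟨P.permRows σ, Q.permRows τ, a, b, ha1, ha, hb1, hb, fun i j k hjk => ?_⟩
  by_contra hne
  have := h i (σ j) (τ k) hne
  rw [hσ, hτ] at this
  omega

/-- Symmetric intertwiners of an indecomposable tuple are scalar. -/
theorem eq_smul_one_of_not_canonicallyDecomposable {A : Fin r → Matrix (Fin p₁) (Fin p₂) ℝ}
    {c d : ℝ} (hc : c ≠ 0) (hd : d ≠ 0) (hR : rowGram A = c • 1) (hC : colGram A = d • 1)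
    (hA : ¬ CanonicallyDecomposable A) {S₁ : Matrix (Fin p₁) (Fin p₁) ℝ}
    {S₂ : Matrix (Fin p₂) (Fin p₂) ℝ} (h₁ : S₁.IsSymm) (h₂ : S₂.IsSymm)
    (h : ∀ i, S₁ * A i = A i * S₂) (hp : 0 < p₁) : ∃ l : ℝ, S₁ = l • 1 ∧ S₂ = l • 1 := by
  obtain ⟨U, x, hU⟩ := h₁.exists_conj_eq_diagonal
  obtain ⟨V, y, hV⟩ := h₂.exists_conj_eq_diagonal
  have hUU : ((U⁻¹ : GL (Fin p₁) ℝ) : Matrix (Fin p₁) (Fin p₁) ℝ) * U.val = 1 := U.inv_mul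
  have hUU' : (U : Matrix (Fin p₁) (Fin p₁) ℝ) * (U⁻¹ : GL (Fin p₁) ℝ) = 1 := U.mul_inv
  have hVV : ((V⁻¹ : GL (Fin p₂) ℝ) : Matrix (Fin p₂) (Fin p₂) ℝ) * V.val = 1 := V.inv_mul
  set U' := ((U⁻¹ : GL (Fin p₁) ℝ) : Matrix (Fin p₁) (Fin p₁) ℝ)
  set V' := ((V⁻¹ : GL (Fin p₂) ℝ) : Matrix (Fin p₂) (Fin p₂) ℝ)
  have hM (i) : diagonal x * (U.val * A i * V') = U.val * A i * V' * diagonal y := by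
    rw [← hU, ← hV]
    calc (U : Matrix (Fin p₁) (Fin p₁) ℝ) * S₁ * U' * (U.val * A i * V')
        = U.val * S₁ * (U' * U.val) * A i * V' := by simp only [Matrix.mul_assoc]
      _ = U.val * (A i * S₂) * V' := by rw [hUU, Matrix.mul_one, Matrix.mul_assoc _ S₁, h]
      _ = U.val * A i * (V' * V.val) * S₂ * V' := by rw [hVV, Matrix.mul_one]; simp only [Matrix.mul_assoc]
      _ = _ := by simp only [Matrix.mul_assoc]
  have hxy (i j k) (hne : (U.val * A i * V') j k ≠ 0) : x j = y k := by
    have := congrFun (congrFun (hM i) j) k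
    rw [diagonal_mul, mul_diagonal, mul_comm] at this
    exact mul_left_cancel₀ hne this
  -- A row vanishing for all `i` would make a diagonal entry of `U A_R U⁻¹ = c I` zero.
  have hrow (j) : ∃ i k, (U.val * A i * V') j k ≠ 0 := by
    by_contra! h0
    have h1 (i) : (U.val * A i * V' * V.val) j = 0 := by
      ext k
      rw [Matrix.mul_apply]
      simp [h0]
    have h2 : ((U : Matrix (Fin p₁) (Fin p₁) ℝ) * rowGram A * U') j j = 0 := by
      simp only [rowGram, Matrix.mul_sum, Matrix.sum_mul, Matrix.sum_apply]
      refine Finset.sum_eq_zero fun i _ => ?_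
      have h3 : (U : Matrix (Fin p₁) (Fin p₁) ℝ) * (A i * (A i)ᵀ) * U'
          = (U.val * A i * V' * V.val) * ((A i)ᵀ * U') := by
        rw [Matrix.mul_assoc _ V' V.val, hVV, Matrix.mul_one]
        simp only [Matrix.mul_assoc]
      rw [h3, Matrix.mul_apply]
      simp [h1]
    rw [hR] at h2
    simp [hUU', hc] at h2
  by_cases hx : ∀ j j', x j = x j'
  · refine ⟨x ⟨0, hp⟩, ?_⟩
    have hS₁ : S₁ = x ⟨0, hp⟩ • 1 := by
      have hd : diagonal x = x ⟨0, hp⟩ • (1 : Matrix (Fin p₁) (Fin p₁) ℝ) := by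
        rw [← diagonal_one, ← diagonal_smul]
        congr 1
        ext j
        simp [hx j ⟨0, hp⟩]
      calc S₁ = (U' * U.val) * S₁ * (U' * U.val) := by simp [hUU]
        _ = U' * (U.val * S₁ * U') * U.val := by simp only [Matrix.mul_assoc]
        _ = _ := by rw [hU, hd]; simp [hUU]
    refine ⟨hS₁, ?_⟩
    have h1 : colGram A * S₂ = x ⟨0, hp⟩ • colGram A := by
      simp only [colGram, Matrix.sum_mul, Finset.smul_sum]
      refine Finset.sum_congr rfl fun i _ => ?_
      rw [Matrix.mul_assoc, ← h, hS₁]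
      simp
    rw [hC, smul_mul, Matrix.one_mul, smul_comm] at h1
    exact smul_right_injective _ hd h1
  -- With two distinct eigenvalues, the indices with eigenvalue `x j₀` form one block and the others
  -- form the second; `hrow` supplies a column on each side.
  · push Not at hx
    obtain ⟨j₀, j₁, hne⟩ := hx
    obtain ⟨i₀, k₀, h₀⟩ := hrow j₀
    obtain ⟨i₁, k₁, h₁⟩ := hrow j₁
    refine absurd (canonicallyDecomposable_of_blocks U V (fun j => x j = x j₀)
      (fun k => y k = x j₀) ⟨j₀, rfl⟩ ⟨j₁, fun h => hne h.symm⟩ ⟨k₀, (hxy _ _ _ h₀).symm⟩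
      ⟨k₁, fun h => hne ((hxy _ _ _ h₁).trans h).symm⟩ fun i j k h => ?_) hA
    rw [hxy i j k h]

/-- A decomposable tuple with scalar Gram matrices has a symmetric intertwiner that is not
scalar. -/
theorem not_canonicallyDecomposable_of_intertwiners {A : Fin r → Matrix (Fin p₁) (Fin p₂) ℝ}
    {c d : ℝ} (hR : rowGram A = c • 1) (hC : colGram A = d • 1)
    (h : ∀ (S₁ : Matrix (Fin p₁) (Fin p₁) ℝ) (S₂ : Matrix (Fin p₂) (Fin p₂) ℝ),
      S₁.IsSymm → S₂.IsSymm → (∀ i, S₁ * A i = A i * S₂) → ∃ l : ℝ, S₁ = l • 1) :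
    ¬ CanonicallyDecomposable A := by
  rintro ⟨P, Q, a, b, ha1, ha, hb1, hb, hPQ⟩
  have hPP : ((P⁻¹ : GL (Fin p₁) ℝ) : Matrix (Fin p₁) (Fin p₁) ℝ) * P.val = 1 := P.inv_mul
  have hPP' : (P : Matrix (Fin p₁) (Fin p₁) ℝ) * (P⁻¹ : GL (Fin p₁) ℝ) = 1 := P.mul_inv
  have hQQ : ((Q⁻¹ : GL (Fin p₂) ℝ) : Matrix (Fin p₂) (Fin p₂) ℝ) * Q.val = 1 := Q.inv_mul
  set P' := ((P⁻¹ : GL (Fin p₁) ℝ) : Matrix (Fin p₁) (Fin p₁) ℝ)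
  set Q' := ((Q⁻¹ : GL (Fin p₂) ℝ) : Matrix (Fin p₂) (Fin p₂) ℝ)
  -- The coordinate projections onto the first block commute with the block form. Conjugated back
  -- they give idempotents `N`, `N₂`, not symmetric in general; adding the transposes makes them
  -- symmetric while keeping them intertwiners.
  let x : Fin p₁ → ℝ := fun j => if j.val < a then 1 else 0
  let y : Fin p₂ → ℝ := fun k => if k.val < b then 1 else 0
  have hxy (i) : diagonal x * (P.val * A i * Q') = P.val * A i * Q' * diagonal y := by
    ext j k
    rw [diagonal_mul, mul_diagonal]
    by_cases hj : j.val < a <;> by_cases hk : k.val < b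
    · simp [x, y, hj, hk]
    · rw [hPQ i j k (by omega)]; simp
    · rw [hPQ i j k (by omega)]; simp
    · simp [x, y, hj, hk]
  have hN (i) : P' * diagonal x * P.val * A i = A i * (Q' * diagonal y * Q.val) := by
    calc P' * diagonal x * P.val * A i = P' * (diagonal x * (P.val * A i * (Q' * Q.val))) := by
          rw [hQQ]; simp only [Matrix.mul_assoc, Matrix.mul_one]
      _ = P' * (diagonal x * (P.val * A i * Q')) * Q.val := by simp only [Matrix.mul_assoc]
      _ = (P' * P.val) * A i * (Q' * diagonal y * Q.val) := by
          rw [hxy]; simp only [Matrix.mul_assoc]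
      _ = _ := by rw [hPP, Matrix.one_mul]
  have hN' := transpose_mul_eq_of_mul_eq hR hC hN
  set N := P' * diagonal x * (P : Matrix (Fin p₁) (Fin p₁) ℝ) with hNdef
  set N₂ := Q' * diagonal y * (Q : Matrix (Fin p₂) (Fin p₂) ℝ)
  obtain ⟨l, hl⟩ := h (N + Nᵀ) (N₂ + N₂ᵀ) (by simp [IsSymm, add_comm]) (by simp [IsSymm, add_comm])
    fun i => by rw [Matrix.add_mul, Matrix.mul_add, hN, hN']
  have hcol (j) : N *ᵥ (P'.col j) = x j • P'.col j := by
    have : N * P' = P' * diagonal x := by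
      rw [hNdef, Matrix.mul_assoc _ _ P', hPP', Matrix.mul_one]
    ext k
    have h1 := congrFun (congrFun this k) j
    rw [mul_diagonal, Matrix.mul_apply] at h1
    simpa [mulVec, dotProduct, mul_comm] using h1
  have hpos (j) : 0 < P'.col j ⬝ᵥ P'.col j := by
    refine lt_of_le_of_ne (by simpa using dotProduct_star_self_nonneg (P'.col j)) fun h0 => ?_
    have h1 : P'.col j = 0 := dotProduct_self_eq_zero.1 h0.symm
    have h2 : ((P : Matrix (Fin p₁) (Fin p₁) ℝ) * P') j j = 0 := by
      rw [Matrix.mul_apply]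
      exact Finset.sum_eq_zero fun k _ => by
        rw [show P' k j = 0 from congrFun h1 k, mul_zero]
    simp [hPP'] at h2
  -- Evaluate the quadratic form of `N + Nᵀ = l I` at an eigenvector of `N` with eigenvalue `x j`.
  -- The indices `0` and `a` then give `l = 2` and `l = 0`.
  have hlx (j) : l = 2 * x j := by
    have h1 := congrArg (fun M => P'.col j ⬝ᵥ M *ᵥ P'.col j) hl
    simp only [add_mulVec, dotProduct_add, hcol, smul_mulVec, one_mulVec, dotProduct_smul,
      smul_eq_mul, mulVec_transpose] at h1
    rw [dotProduct_comm (P'.col j) (P'.col j ᵥ* N), ← dotProduct_mulVec, hcol, dotProduct_smul, smul_eq_mul] at h1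
    have := (hpos j).ne'
    have h2 : (l - 2 * x j) * (P'.col j ⬝ᵥ P'.col j) = 0 := by linarith
    rcases mul_eq_zero.1 h2 with h3 | h3
    · linarith
    · exact absurd h3 this
  have e1 := hlx ⟨0, by omega⟩
  have e2 := hlx ⟨a, ha⟩
  simp only [x, lt_irrefl, if_false, show 0 < a from ha1, if_true] at e1 e2
  linarith

end CoreCov

/-! ### Quadratic level sets and openness of injectivity -/

/-- A curve in a level set of a vector-valued quadratic map, with a prescribed velocity. -/
theorem exists_contDiffAt_curve_bilinear {E W : Type*} [NormedAddCommGroup E] [NormedSpace ℝ E]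
    [AddCommGroup W] [Module ℝ W] [FiniteDimensional ℝ E] [FiniteDimensional ℝ W]
    (b : E →ₗ[ℝ] E →ₗ[ℝ] W) (hb : ∀ x y, b x y = b y x) {V : Submodule ℝ W}
    (hV : ∀ x y, b x y ∈ V) {x v : E} (hsurj : ∀ w ∈ V, ∃ y, b x y = w) (hv : b x v = 0) :
    ∃ γ : ℝ → E, ContDiffAt ℝ ω γ 0 ∧ γ 0 = x ∧ HasDerivAt γ v 0 ∧
      ∀ᶠ t in 𝓝 0, b (γ t) (γ t) = b x x := by
  -- The values are projected to `V` and read in coordinates: this makes the derivative surjective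
  -- and provides a norm on the target.
  obtain ⟨π₀, hπ₀⟩ := V.subtype.exists_leftInverse_of_injective (Submodule.ker_subtype _)
  have hπ (w : V) : π₀ w = w := LinearMap.congr_fun hπ₀ w
  obtain ⟨e⟩ : Nonempty (V ≃ₗ[ℝ] (Fin (Module.finrank ℝ V) → ℝ)) :=
    ⟨(Module.finBasis ℝ V).equivFun⟩
  let β : E →L[ℝ] E →L[ℝ] (Fin (Module.finrank ℝ V) → ℝ) :=
    (b.compr₂ (e.toLinearMap ∘ₗ π₀)).toContinuousBilinearMap
  have hβ (y z) : β y z = e ⟨b y z, hV y z⟩ := congrArg e (hπ ⟨_, hV y z⟩)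
  have hβc (y z) : β y z = β z y := by simp_rw [hβ, hb]
  let G : E → Fin (Module.finrank ℝ V) → ℝ := fun y => β y y
  have hG : ContDiff ℝ ω G := β.isBoundedBilinearMap.contDiff.comp (contDiff_id.prodMk contDiff_id)
  have hG' : HasFDerivAt G ((2 : ℝ) • β x) x := by
    refine (β.hasFDerivAt_of_bilinear (hasFDerivAt_id x) (hasFDerivAt_id x)).congr_fderiv ?_
    refine ContinuousLinearMap.ext fun y => ?_
    simp [hβc y x, two_smul]
  have hsurj' : Function.Surjective ((2 : ℝ) • β x) := by
    intro w
    obtain ⟨y, hy⟩ := hsurj (e.symm w) (e.symm w).2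
    refine ⟨(2 : ℝ)⁻¹ • y, ?_⟩
    have : β x y = w := by simp [hβ, hy]
    simp [this]
  have hv' : ((2 : ℝ) • β x) v = 0 := by
    have h0 : (⟨b x v, hV x v⟩ : V) = 0 := Subtype.ext hv
    simp [hβ, h0]
  obtain ⟨γ, hγ, hγ0, hγ', hlev⟩ := exists_contDiffAt_curve_levelSet hG hG' hsurj' hv'
  refine ⟨γ, hγ, hγ0, hγ', hlev.mono fun t ht => ?_⟩
  have ht' : β (γ t) (γ t) = β x x := ht
  rw [hβ, hβ] at ht'
  exact congrArg Subtype.val (e.injective ht')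

/-- Injectivity of a linear map that depends linearly on a parameter is an open condition. -/
theorem eventually_injective_of_bilinear {E F G : Type*} [NormedAddCommGroup E] [NormedSpace ℝ E]
    [AddCommGroup F] [Module ℝ F] [NormedAddCommGroup G] [NormedSpace ℝ G]
    [FiniteDimensional ℝ E] [FiniteDimensional ℝ F] (τ : E →ₗ[ℝ] F →ₗ[ℝ] G) {x : E}
    (hx : Function.Injective (τ x)) : ∀ᶠ y in 𝓝 x, Function.Injective (τ y) := by
  let b := Module.finBasis ℝ F
  have hcont : Continuous fun y i => τ y (b i) :=
    continuous_pi fun i => (τ.flip (b i)).continuous_of_finiteDimensional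
  have hli : LinearIndependent ℝ fun i => τ x (b i) :=
    b.linearIndependent.map' _ (LinearMap.ker_eq_bot.2 hx)
  exact (hcont.continuousAt.eventually hli.eventually).mono fun y hy =>
    LinearMap.injective_of_linearIndependent b.span_eq hy

/-! ### The Gram map, its linearization and the adjoint -/

namespace CoreCov

variable {p₁ p₂ r : ℕ}

/-- Full column rank becomes the nonvanishing of a polynomial, hence an open condition. -/
theorem rank_vecCols_iff_det_ne_zero (hr : r ≤ p₁ * p₂) (A : Fin r → Matrix (Fin p₁) (Fin p₂) ℝ) :
    (vecCols A).rank = min (p₁ * p₂) r ↔ ((vecCols A)ᵀ * vecCols A).det ≠ 0 := by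
  rw [min_eq_right hr]
  constructor
  · intro h
    have hinj : Function.Injective (vecCols A).mulVec := by
      have h1 := LinearMap.finrank_range_add_finrank_ker (vecCols A).mulVecLin
      have h2 : Module.finrank ℝ (LinearMap.range (vecCols A).mulVecLin) = r := h
      rw [h2, Module.finrank_fin_fun, Nat.add_eq_left, Submodule.finrank_eq_zero] at h1
      exact LinearMap.ker_eq_bot.1 h1
    have h3 := (PosDef.conjTranspose_mul_self _ hinj).det_pos.ne'
    rwa [conjTranspose_eq_transpose_of_trivial] at h3
  · intro h
    rw [← rank_transpose_mul_self]
    simpa using rank_of_isUnit _ ((isUnit_iff_isUnit_det _).2 (isUnit_iff_ne_zero.2 h))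

/-- The fixed trace removes the normalization, and scalar Gram matrices make the rank conditions on
`A_R` and `A_C` automatic. -/
theorem mem_setD_iff (hp₁ : 0 < p₁) (hp₂ : 0 < p₂) {A : Fin r → Matrix (Fin p₁) (Fin p₂) ℝ} :
    A ∈ setD p₁ p₂ r ↔ (vecCols A).rank = min (p₁ * p₂) r ∧ ¬ CanonicallyDecomposable A ∧
      rowGram A = (p₂ : ℝ) • 1 ∧ colGram A = (p₁ : ℝ) • 1 := by
  have h₁ : (p₁ : ℝ) ≠ 0 := by positivity
  have h₂ : (p₂ : ℝ) ≠ 0 := by positivity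
  have hrank {n : ℕ} {c : ℝ} (hc : c ≠ 0) : (c • (1 : Matrix (Fin n) (Fin n) ℝ)).rank = n := by
    rw [rank_of_isUnit, Fintype.card_fin]
    exact (isUnit_iff_isUnit_det _).2 (by simp [hc])
  simp only [setD, setH, mapF, Set.mem_ofPred_eq, Prod.mk.injEq]
  constructor
  · rintro ⟨⟨h, -, -, hd⟩, hR, hC, ht⟩
    rw [ht] at hR hC
    refine ⟨h, hd, ?_, ?_⟩
    · rw [inv_smul_eq_iff₀ (by positivity)] at hR
      rw [hR, smul_smul]
      congr 1
      field_simp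
    · rw [inv_smul_eq_iff₀ (by positivity)] at hC
      rw [hC, smul_smul]
      congr 1
      field_simp
  · rintro ⟨h, hd, hR, hC⟩
    have ht : (rowGram A).trace = p₁ * p₂ := by simp [hR, mul_comm]
    rw [ht, hR, hC]
    refine ⟨⟨h, hrank h₂, hrank h₁, hd⟩, ?_, ?_, rfl⟩ <;> rw [smul_smul] <;> congr 1 <;> field_simp

/-- The pairs of symmetric matrices with equal traces. -/
def symPairs (p₁ p₂ : ℕ) :
    Submodule ℝ (Matrix (Fin p₁) (Fin p₁) ℝ × Matrix (Fin p₂) (Fin p₂) ℝ) where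
  carrier := {S | S.1.IsSymm ∧ S.2.IsSymm ∧ S.1.trace = S.2.trace}
  add_mem' := fun h h' => ⟨h.1.add h'.1, h.2.1.add h'.2.1, by simp [h.2.2, h'.2.2]⟩
  zero_mem' := ⟨isSymm_zero, isSymm_zero, by simp⟩
  smul_mem' := fun c _ h => ⟨h.1.smul c, h.2.1.smul c, by simp [h.2.2]⟩

/-- The polarization of `A ↦ (2 A_R, 2 A_C)`. -/
def gramPolar : (Fin r → Matrix (Fin p₁) (Fin p₂) ℝ) →ₗ[ℝ]
    (Fin r → Matrix (Fin p₁) (Fin p₂) ℝ) →ₗ[ℝ]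
      (Matrix (Fin p₁) (Fin p₁) ℝ × Matrix (Fin p₂) (Fin p₂) ℝ) :=
  LinearMap.mk₂ ℝ
    (fun A B => (∑ i, (A i * (B i)ᵀ + B i * (A i)ᵀ), ∑ i, ((A i)ᵀ * B i + (B i)ᵀ * A i)))
    (fun A A' B => by
      ext1 <;> simp only [Prod.fst_add, Prod.snd_add, ← Finset.sum_add_distrib] <;>
        refine Finset.sum_congr rfl fun i _ => ?_ <;>
        simp only [Pi.add_apply, transpose_add, Matrix.add_mul, Matrix.mul_add] <;> abel)
    (fun c A B => by simp [Finset.smul_sum])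
    (fun A B B' => by
      ext1 <;> simp only [Prod.fst_add, Prod.snd_add, ← Finset.sum_add_distrib] <;>
        refine Finset.sum_congr rfl fun i _ => ?_ <;>
        simp only [Pi.add_apply, transpose_add, Matrix.add_mul, Matrix.mul_add] <;> abel)
    (fun c A B => by simp [Finset.smul_sum])

theorem gramPolar_apply (A B : Fin r → Matrix (Fin p₁) (Fin p₂) ℝ) : gramPolar A B =
    (∑ i, (A i * (B i)ᵀ + B i * (A i)ᵀ), ∑ i, ((A i)ᵀ * B i + (B i)ᵀ * A i)) := rfl

theorem gramPolar_self (A : Fin r → Matrix (Fin p₁) (Fin p₂) ℝ) :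
    gramPolar A A = (2 : ℝ) • (rowGram A, colGram A) := by
  simp [gramPolar_apply, rowGram, colGram, Finset.sum_add_distrib, two_smul]

theorem gramPolar_comm (A B : Fin r → Matrix (Fin p₁) (Fin p₂) ℝ) :
    gramPolar A B = gramPolar B A := by
  simp only [gramPolar_apply, add_comm]

theorem gramPolar_mem_symPairs (A B : Fin r → Matrix (Fin p₁) (Fin p₂) ℝ) :
    gramPolar A B ∈ symPairs p₁ p₂ := by
  refine ⟨?_, ?_, ?_⟩
  · simp [IsSymm, gramPolar_apply, transpose_sum, add_comm]
  · simp [IsSymm, gramPolar_apply, transpose_sum, add_comm]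
  · simp only [gramPolar_apply, trace_sum, trace_add]
    refine Finset.sum_congr rfl fun i _ => ?_
    rw [trace_mul_comm, trace_mul_comm (B i), add_comm]

/-- The map `(A, (S₁, S₂)) ↦ (S₁ Aᵢ + Aᵢ S₂)ᵢ`. -/
def intertwine : (Fin r → Matrix (Fin p₁) (Fin p₂) ℝ) →ₗ[ℝ] symPairs p₁ p₂ →ₗ[ℝ]
    (Fin r → Matrix (Fin p₁) (Fin p₂) ℝ) :=
  LinearMap.mk₂ ℝ (fun A S i => S.1.1 * A i + A i * S.1.2)
    (fun A A' S => by
      ext1 i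
      simp only [Pi.add_apply, Matrix.add_mul, Matrix.mul_add]
      abel)
    (fun c A S => by ext1 i; simp)
    (fun A S S' => by
      ext1 i
      simp only [Pi.add_apply, Submodule.coe_add, Prod.fst_add, Prod.snd_add, Matrix.add_mul,
        Matrix.mul_add]
      abel)
    (fun c A S => by ext1 i; simp)

theorem intertwine_apply (A : Fin r → Matrix (Fin p₁) (Fin p₂) ℝ) (S : symPairs p₁ p₂) (i : Fin r) :
    intertwine A S i = S.1.1 * A i + A i * S.1.2 := rfl

/-- `intertwine A` is, up to a factor, the adjoint of `gramPolar A`. -/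
theorem trace_mul_gramPolar (A B : Fin r → Matrix (Fin p₁) (Fin p₂) ℝ) (S : symPairs p₁ p₂) :
    (S.1.1 * (gramPolar A B).1).trace + (S.1.2 * (gramPolar A B).2).trace =
      2 * ∑ i, (intertwine A S i * (B i)ᵀ).trace := by
  obtain ⟨⟨S₁, S₂⟩, h₁ : S₁.IsSymm, h₂ : S₂.IsSymm, -⟩ := S
  simp only [gramPolar_apply, intertwine_apply, trace_sum, Finset.mul_sum,
    ← Finset.sum_add_distrib]
  refine Finset.sum_congr rfl fun i _ => ?_
  have e1 : (S₁ * (B i * (A i)ᵀ)).trace = (S₁ * A i * (B i)ᵀ).trace := by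
    rw [← trace_transpose, transpose_mul, transpose_mul, transpose_transpose, h₁.eq,
      trace_mul_comm, Matrix.mul_assoc]
  have e2 : (S₂ * ((B i)ᵀ * A i)).trace = (A i * S₂ * (B i)ᵀ).trace := by
    rw [trace_mul_comm, Matrix.mul_assoc, trace_mul_comm]
  have e3 : (S₂ * ((A i)ᵀ * B i)).trace = (A i * S₂ * (B i)ᵀ).trace := by
    rw [← trace_transpose, transpose_mul, transpose_mul, transpose_transpose, h₂.eq,
      ← e2, trace_mul_comm]
  rw [Matrix.mul_add, Matrix.mul_add, Matrix.add_mul, trace_add, trace_add, trace_add, e1, e2, e3,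
    Matrix.mul_assoc S₁]
  ring

/-- Indecomposability leaves only `(l I, -l I)` in the kernel, and the equal-trace condition gives
`l (p₁ + p₂) = 0`. -/
theorem intertwine_injective {A : Fin r → Matrix (Fin p₁) (Fin p₂) ℝ} (hp₁ : 0 < p₁)
    (hp₂ : 0 < p₂) (hA : ¬ CanonicallyDecomposable A) (hR : rowGram A = (p₂ : ℝ) • 1)
    (hC : colGram A = (p₁ : ℝ) • 1) : Function.Injective (intertwine A) := by
  rw [injective_iff_map_eq_zero]
  rintro ⟨⟨S₁, S₂⟩, h₁ : S₁.IsSymm, h₂ : S₂.IsSymm, ht : S₁.trace = S₂.trace⟩ h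
  have h' (i) : S₁ * A i = A i * -S₂ := by
    rw [Matrix.mul_neg]
    exact eq_neg_of_add_eq_zero_left (congrFun h i)
  obtain ⟨l, rfl, hl⟩ := eq_smul_one_of_not_canonicallyDecomposable (by positivity)
    (by positivity) hR hC hA h₁ h₂.neg h' hp₁
  obtain rfl : S₂ = -(l • 1) := by rw [← hl, neg_neg]
  have hl0 : l * (p₁ + p₂) = 0 := by
    simp only [trace_smul, trace_neg, trace_one, Fintype.card_fin, smul_eq_mul] at ht
    linarith
  have : l = 0 := (mul_eq_zero.1 hl0).resolve_right (by positivity)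
  simp [this]

/-- A symmetric intertwining pair is shifted to `(S₁ - l I, l I - S₂)`, a kernel element; `l` is the
value that equalizes the two traces. -/
theorem not_canonicallyDecomposable_of_intertwine_injective
    {A : Fin r → Matrix (Fin p₁) (Fin p₂) ℝ} (hp₁ : 0 < p₁)
    {c d : ℝ} (hR : rowGram A = c • 1) (hC : colGram A = d • 1)
    (hA : Function.Injective (intertwine A)) : ¬ CanonicallyDecomposable A := by
  refine not_canonicallyDecomposable_of_intertwiners hR hC fun S₁ S₂ h₁ h₂ h => ?_
  set l : ℝ := (S₁.trace + S₂.trace) / (p₁ + p₂)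
  have hmem : (S₁ - l • 1, l • 1 - S₂) ∈ symPairs p₁ p₂ := by
    refine ⟨h₁.sub (isSymm_one.smul l), (isSymm_one.smul l).sub h₂, ?_⟩
    have : (p₁ + p₂ : ℝ) ≠ 0 := by positivity
    simp only [trace_sub, trace_smul, trace_one, Fintype.card_fin, smul_eq_mul, l]
    field_simp
    ring
  have h0 : intertwine A ⟨_, hmem⟩ = 0 := by
    ext1 i
    rw [intertwine_apply]
    simp [Matrix.sub_mul, Matrix.mul_sub, h i]
  have h1 := congrArg (fun S : symPairs p₁ p₂ => S.1.1) (hA (h0.trans (map_zero _).symm))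
  exact ⟨l, sub_eq_zero.1 h1⟩

/-- By adjointness, pairing `S` with `gramPolar A (intertwine A S)` gives `2 ‖intertwine A S‖²`. The
composite is therefore an injective endomorphism of a finite-dimensional space, hence onto. -/
theorem exists_gramPolar_eq {A : Fin r → Matrix (Fin p₁) (Fin p₂) ℝ}
    (hA : Function.Injective (intertwine A)) {S} (hS : S ∈ symPairs p₁ p₂) :
    ∃ B, gramPolar A B = S := by
  let T : symPairs p₁ p₂ →ₗ[ℝ] symPairs p₁ p₂ :=
    (gramPolar A ∘ₗ intertwine A).codRestrict _ fun _ => gramPolar_mem_symPairs _ _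
  have hT : Function.Injective T := by
    rw [injective_iff_map_eq_zero]
    intro S hS
    have h0 : gramPolar A (intertwine A S) = 0 := congrArg Subtype.val hS
    have h1 := trace_mul_gramPolar A (intertwine A S) S
    rw [h0] at h1
    simp only [Prod.fst_zero, Prod.snd_zero, Matrix.mul_zero, trace_zero, add_zero,
      zero_eq_mul, OfNat.ofNat_ne_zero, false_or] at h1
    rw [Finset.sum_eq_zero_iff_of_nonneg fun i _ => by
      simpa using (posSemidef_self_mul_conjTranspose (intertwine A S i)).trace_nonneg] at h1
    refine (injective_iff_map_eq_zero _).1 hA S (funext fun i => ?_)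
    exact trace_mul_conjTranspose_self_eq_zero_iff.1 (by simpa using h1 i (Finset.mem_univ i))
  obtain ⟨S', hS'⟩ := LinearMap.injective_iff_surjective.1 hT ⟨S, hS⟩
  exact ⟨intertwine A S', congrArg Subtype.val hS'⟩

open scoped Matrix.Norms.Elementwise in
/-- A curve in `D` whose velocity is a prescribed solution of the linearized equations. -/
theorem exists_curve_setD (hp₁ : 0 < p₁) (hp₂ : 0 < p₂) (hr : r ≤ p₁ * p₂)
    {A B : Fin r → Matrix (Fin p₁) (Fin p₂) ℝ} (hA : A ∈ setD p₁ p₂ r) (hB : gramPolar A B = 0) :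
    ∃ γ : ℝ → Fin r → Matrix (Fin p₁) (Fin p₂) ℝ, ContDiffAt ℝ ω γ 0 ∧ γ 0 = A ∧
      HasDerivAt γ B 0 ∧ ∀ᶠ t in 𝓝 0, γ t ∈ setD p₁ p₂ r := by
  obtain ⟨hrank, hdec, hR, hC⟩ := (mem_setD_iff hp₁ hp₂).1 hA
  have hinj := intertwine_injective hp₁ hp₂ hdec hR hC
  obtain ⟨γ, hγ, hγ0, hγ', hlev⟩ := exists_contDiffAt_curve_bilinear gramPolar gramPolar_comm
    gramPolar_mem_symPairs (fun S hS => exists_gramPolar_eq hinj hS) hB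
  refine ⟨γ, hγ, hγ0, hγ', ?_⟩
  have hcont : Tendsto γ (𝓝 0) (𝓝 A) := hγ0 ▸ hγ.continuousAt
  have hev₁ : ∀ᶠ X in 𝓝 A, ((vecCols X)ᵀ * vecCols X).det ≠ 0 := by
    have hc : Continuous fun X : Fin r → Matrix (Fin p₁) (Fin p₂) ℝ =>
        ((vecCols X)ᵀ * vecCols X).det := by
      have h1 : Continuous fun X : Fin r → Matrix (Fin p₁) (Fin p₂) ℝ => vecCols X :=
        continuous_matrix fun s i => ((continuous_apply i).matrix_elem s.2 s.1)
      exact (h1.matrix_transpose.matrix_mul h1).matrix_det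
    exact hc.continuousAt.eventually_ne ((rank_vecCols_iff_det_ne_zero hr A).1 hrank)
  have hev₂ : ∀ᶠ X in 𝓝 A, Function.Injective (intertwine X) :=
    eventually_injective_of_bilinear intertwine hinj
  filter_upwards [hcont.eventually hev₁, hcont.eventually hev₂, hlev] with t h₁ h₂ h₃
  have h₄ : (rowGram (γ t), colGram (γ t)) = (rowGram A, colGram A) := by
    have h5 : gramPolar (γ t) (γ t) = gramPolar A A := h₃
    rw [gramPolar_self, gramPolar_self] at h5
    exact smul_right_injective _ (two_ne_zero' ℝ) h5
  rw [Prod.mk.injEq, hR, hC] at h₄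
  exact (mem_setD_iff hp₁ hp₂).2 ⟨(rank_vecCols_iff_det_ne_zero hr _).2 h₁,
    not_canonicallyDecomposable_of_intertwine_injective hp₁ h₄.1 h₄.2 h₂, h₄⟩

end CoreCov

/-! ### Symmetric matrices of the form `X Bᵀ + B Xᵀ` -/

/-- A symmetric matrix whose quadratic form vanishes on the left kernel of `X` is of the form
`X Bᵀ + B Xᵀ`, provided that `X` has full column rank. -/
theorem Matrix.IsSymm.exists_eq_mul_transpose_add {m n : Type*} [Fintype m] [Fintype n]
    [DecidableEq m] [DecidableEq n] {X : Matrix m n ℝ} (hX : (Xᵀ * X).det ≠ 0) {W : Matrix m m ℝ}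
    (hW : W.IsSymm) (hq : ∀ v, Xᵀ *ᵥ v = 0 → v ⬝ᵥ W *ᵥ v = 0) :
    ∃ B : Matrix m n ℝ, W = X * Bᵀ + B * Xᵀ := by
  -- `Y Xᵀ` is the orthogonal projection onto the column space of `X`, and `N` the one onto `ker
  -- Xᵀ`.
  set Y : Matrix m n ℝ := X * (Xᵀ * X)⁻¹ with hY
  have hXY : Xᵀ * Y = 1 := by
    rw [hY, ← Matrix.mul_assoc, mul_nonsing_inv _ (isUnit_iff_ne_zero.2 hX)]
  set N : Matrix m m ℝ := 1 - Y * Xᵀ with hN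
  have hXN : Xᵀ * N = 0 := by
    rw [hN, Matrix.mul_sub, ← Matrix.mul_assoc, hXY, Matrix.one_mul, Matrix.mul_one, sub_self]
  have hYX : X * Yᵀ = Y * Xᵀ := by
    rw [hY, transpose_mul, transpose_nonsing_inv, transpose_mul, transpose_transpose,
      Matrix.mul_assoc]
  have hNN : Nᵀ * W * N = 0 := by
    have hsymm : (Nᵀ * W * N).IsSymm := by
      rw [IsSymm, transpose_mul, transpose_mul, transpose_transpose, hW.eq, Matrix.mul_assoc]
    have hquad (v) : v ⬝ᵥ (Nᵀ * W * N) *ᵥ v = 0 := by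
      have := hq (N *ᵥ v) (by rw [mulVec_mulVec, hXN, zero_mulVec])
      rw [← this, ← mulVec_mulVec, ← mulVec_mulVec, dotProduct_mulVec, vecMul_transpose]
    ext j k
    set M := Nᵀ * W * N
    have h1 := hquad (Pi.single j 1 + Pi.single k 1)
    have h2 := hquad (Pi.single j 1)
    have h3 := hquad (Pi.single k 1)
    simp only [mulVec_add, add_dotProduct, dotProduct_add, mulVec_single_one,
      single_one_dotProduct, col_apply] at h1 h2 h3
    have h4 := hsymm.apply j k
    simp only [Matrix.zero_apply]
    linarith
  set Z := Y * Xᵀ with hZ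
  have hZT : Zᵀ = Z := by rw [hZ, transpose_mul, transpose_transpose, hYX]
  clear_value N Z
  -- The factor `1/2` splits `Z W Z` between the two summands, so that they add up to `Z W + W Z - Z
  -- W Z`, which is `W` because `N W N = 0`.
  refine ⟨(W - (1 / 2 : ℝ) • (Z * W)) * Y, ?_⟩
  have hB : (W - (1 / 2 : ℝ) • (Z * W)) * Y * Xᵀ = W * Z - (1 / 2 : ℝ) • (Z * W * Z) := by
    rw [Matrix.mul_assoc, ← hZ, Matrix.sub_mul, Matrix.smul_mul]
  have hB' : X * ((W - (1 / 2 : ℝ) • (Z * W)) * Y)ᵀ = Z * W - (1 / 2 : ℝ) • (Z * W * Z) := by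
    rw [← transpose_transpose (X * _), transpose_mul, transpose_transpose, hB, transpose_sub,
      transpose_smul, transpose_mul, transpose_mul, transpose_mul, hZT, hW.eq, Matrix.mul_assoc]
  have h : Z * W * Z = W * Z + Z * W - W := by
    simp only [hN, transpose_sub, transpose_one, hZT, Matrix.sub_mul, Matrix.mul_sub,
      Matrix.one_mul, Matrix.mul_one] at hNN
    rw [← sub_eq_zero, ← hNN]
    abel
  rw [hB, hB', h]
  module

/-! ### The null space of `J(A)` -/

namespace CoreCov

variable {p₁ p₂ r : ℕ}

theorem vecCols_surjective :
    Function.Surjective (vecCols : (Fin r → Matrix (Fin p₁) (Fin p₂) ℝ) → _) :=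
  fun B => ⟨fun i => Matrix.of fun j k => B (k, j) i, rfl⟩

theorem blockRow_mulVec_vec_vecCols {m : Type*} (M : Fin r → Matrix m (Fin p₂ × Fin p₁) ℝ)
    (B : Fin r → Matrix (Fin p₁) (Fin p₂) ℝ) :
    blockRow M *ᵥ Matrix.vec (vecCols B) = ∑ i, M i *ᵥ Matrix.vec (B i) := by
  ext s
  simp [blockRow, mulVec, dotProduct, vecCols, Fintype.sum_prod_type]

theorem one_add_commutation_mulVec_vec {n : ℕ} (X : Matrix (Fin n) (Fin n) ℝ) :
    (1 + commutation n n) *ᵥ Matrix.vec X = Matrix.vec (X + Xᵀ) := by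
  have := commutation_mulVec_vec Xᵀ
  rw [transpose_transpose] at this
  rw [add_mulVec, one_mulVec, this, vec_add]

theorem J₁_mulVec (A B : Fin r → Matrix (Fin p₁) (Fin p₂) ℝ) :
    J₁ A *ᵥ Matrix.vec (vecCols B) = (1 / ((p₁ : ℝ) * p₂)) • Matrix.vec (gramPolar A B).1 -
      (2 / ((p₁ : ℝ) ^ 2 * p₂)) • (stackVec A ⬝ᵥ Matrix.vec (vecCols B)) •
        Matrix.vec (1 : Matrix (Fin p₁) (Fin p₁) ℝ) := by
  rw [J₁, sub_mulVec, smul_mulVec, smul_mulVec, ← mulVec_mulVec, blockRow_mulVec_vec_vecCols,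
    vecMulVec_mulVec]
  simp only [kronecker_mulVec_vec, Matrix.one_mul, ← vec_sum, one_add_commutation_mulVec_vec,
    transpose_sum, transpose_mul, transpose_transpose, op_smul_eq_smul, gramPolar_apply,
    ← Finset.sum_add_distrib]
  simp only [add_comm]

theorem J₂_mulVec (A B : Fin r → Matrix (Fin p₁) (Fin p₂) ℝ) :
    J₂ A *ᵥ Matrix.vec (vecCols B) = (1 / ((p₁ : ℝ) * p₂)) • Matrix.vec (gramPolar A B).2 -
      (2 / ((p₁ : ℝ) * (p₂ : ℝ) ^ 2)) • (stackVec A ⬝ᵥ Matrix.vec (vecCols B)) •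
        Matrix.vec (1 : Matrix (Fin p₂) (Fin p₂) ℝ) := by
  rw [J₂, sub_mulVec, smul_mulVec, smul_mulVec, ← mulVec_mulVec, blockRow_mulVec_vec_vecCols,
    vecMulVec_mulVec]
  simp only [kronecker_mulVec_vec, transpose_one, Matrix.mul_one, ← vec_sum,
    one_add_commutation_mulVec_vec, transpose_sum, transpose_mul, transpose_transpose,
    ← Finset.sum_add_distrib, gramPolar_apply, op_smul_eq_smul]

theorem J₃_mulVec (A : Fin r → Matrix (Fin p₁) (Fin p₂) ℝ) (v : Fin r × (Fin p₂ × Fin p₁) → ℝ) :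
    J₃ A *ᵥ v = fun _ => 2 * (stackVec A ⬝ᵥ v) := by
  ext
  simp [J₃, mulVec, dotProduct, Finset.mul_sum, mul_assoc]

theorem trace_gramPolar_fst (A B : Fin r → Matrix (Fin p₁) (Fin p₂) ℝ) :
    (gramPolar A B).1.trace = 2 * (stackVec A ⬝ᵥ Matrix.vec (vecCols B)) := by
  have h (i) : (A i * (B i)ᵀ).trace = Matrix.vec (A i) ⬝ᵥ Matrix.vec (B i) := by
    rw [vec_dotProduct_vec, ← trace_transpose, transpose_mul, transpose_transpose, trace_mul_comm]
  have h' : stackVec A ⬝ᵥ Matrix.vec (vecCols B) = ∑ i, (A i * (B i)ᵀ).trace := by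
    simp [h, dotProduct, stackVec, vecCols, Fintype.sum_prod_type]
  rw [h', gramPolar_apply, trace_sum, Finset.mul_sum]
  refine Finset.sum_congr rfl fun i _ => ?_
  rw [trace_add, ← trace_transpose (B i * (A i)ᵀ), transpose_mul, transpose_transpose, two_mul]

/-- The null space of `J(A)` is the space of solutions of the linearized Gram equations. -/
theorem vec_vecCols_mem_ker_J_iff (hp₁ : 0 < p₁) (hp₂ : 0 < p₂)
    (A B : Fin r → Matrix (Fin p₁) (Fin p₂) ℝ) :
    Matrix.vec (vecCols B) ∈ LinearMap.ker (J A).mulVecLin ↔ gramPolar A B = 0 := by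
  have hp : 1 / ((p₁ : ℝ) * p₂) ≠ 0 := by positivity
  rw [LinearMap.mem_ker, mulVecLin_apply, J, fromRows_mulVec, fromRows_mulVec, J₁_mulVec,
    J₂_mulVec, J₃_mulVec]
  constructor
  · intro h
    have h₁ := congrArg (· ∘ Sum.inl) h
    have h₂ := congrArg (· ∘ Sum.inl) (congrArg (· ∘ Sum.inr) h)
    have h₃ := congrFun (congrArg (· ∘ Sum.inr) (congrArg (· ∘ Sum.inr) h)) ()
    simp only [Sum.elim_comp_inl, Sum.elim_comp_inr] at h₁ h₂ h₃
    -- The block `J₃` kills the rank-one corrections in `J₁` and `J₂`.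
    have hs : stackVec A ⬝ᵥ Matrix.vec (vecCols B) = 0 := by simpa using h₃
    rw [hs, zero_smul, smul_zero, sub_zero] at h₁ h₂
    exact Prod.ext (vec_eq_zero_iff.1 ((smul_eq_zero.1 h₁).resolve_left hp))
      (vec_eq_zero_iff.1 ((smul_eq_zero.1 h₂).resolve_left hp))
  · intro h
    have hs : stackVec A ⬝ᵥ Matrix.vec (vecCols B) = 0 := by
      simpa [h] using (trace_gramPolar_fst A B).symm
    rw [hs, h]
    ext (_ | _ | _) <;> simp

/-! ### Tangent vectors of `C` and `C⁺` -/

/-- With its companion for the second component, this shows that `gramPolar A B` depends only on the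
velocity of `X Xᵀ`, through its partial traces. -/
theorem gramPolar_fst_apply (A B : Fin r → Matrix (Fin p₁) (Fin p₂) ℝ) (j j' : Fin p₁) :
    (gramPolar A B).1 j j' = ∑ k, (vecCols A * (vecCols B)ᵀ + vecCols B * (vecCols A)ᵀ)
      (k, j) (k, j') := by
  simp only [gramPolar_apply, Matrix.sum_apply, Matrix.add_apply, Matrix.mul_apply, transpose_apply,
    vecCols, Matrix.of_apply, Matrix.vec, Finset.sum_add_distrib]
  congr 1 <;> exact Finset.sum_comm

theorem gramPolar_snd_apply (A B : Fin r → Matrix (Fin p₁) (Fin p₂) ℝ) (k k' : Fin p₂) :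
    (gramPolar A B).2 k k' = ∑ j, (vecCols A * (vecCols B)ᵀ + vecCols B * (vecCols A)ᵀ)
      (k, j) (k', j) := by
  simp only [gramPolar_apply, Matrix.sum_apply, Matrix.add_apply, Matrix.mul_apply, transpose_apply,
    vecCols, Matrix.of_apply, Matrix.vec, Finset.sum_add_distrib]
  congr 1 <;> exact Finset.sum_comm

theorem hasDerivAt_eq_zero_of_eqOn_Ioo {f : ℝ → ℝ} {c f' ε : ℝ} (hε : 0 < ε)
    (hf : HasDerivAt f f' 0) (h : ∀ t ∈ Set.Ioo (-ε) ε, f t = c) : f' = 0 := by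
  refine hf.unique ((hasDerivAt_const (0 : ℝ) c).congr_of_eventuallyEq ?_)
  filter_upwards [Ioo_mem_nhds (neg_lt_zero.2 hε) hε] with t ht using h t ht

/-- Tangent vectors of `C⁺` have vanishing partial traces. -/
theorem partial_traces_of_mem_tangentSpaceAt_setCPlus (hp₁ : 0 < p₁) (hp₂ : 0 < p₂) {X W}
    (hW : W ∈ tangentSpaceAt (setCPlus p₁ p₂ r) X) :
    (∀ j j', ∑ k, W (k, j) (k, j') = 0) ∧ ∀ k k', ∑ j, W (k, j) (k', j) = 0 := by
  obtain ⟨ε, hε, γ, -, hmem, -, hder⟩ := hW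
  have hconst (t) (ht : t ∈ Set.Ioo (-ε) ε) :
      (∀ j j', ∑ k, γ t (k, j) (k, j') = ((p₂ : ℝ) • (1 : Matrix (Fin p₁) (Fin p₁) ℝ)) j j') ∧
      ∀ k k', ∑ j, γ t (k, j) (k', j) = ((p₁ : ℝ) • (1 : Matrix (Fin p₂) (Fin p₂) ℝ)) k k' := by
    obtain ⟨_, ⟨A, hA, rfl⟩, hAt⟩ := hmem t ht
    obtain ⟨-, -, hR, hC⟩ := (mem_setD_iff hp₁ hp₂).1 hA
    rw [← hAt, ← hR, ← hC]
    constructor <;> intro j j' <;>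
      simp only [Matrix.mul_apply, transpose_apply, vecCols, Matrix.of_apply, Matrix.vec, rowGram,
        colGram, Matrix.sum_apply] <;> exact Finset.sum_comm
  exact ⟨fun j j' => hasDerivAt_eq_zero_of_eqOn_Ioo hε
      (HasDerivAt.fun_sum fun k _ => hder (k, j) (k, j')) fun t ht => (hconst t ht).1 j j',
    fun k k' => hasDerivAt_eq_zero_of_eqOn_Ioo hε
      (HasDerivAt.fun_sum fun j _ => hder (k, j) (k', j)) fun t ht => (hconst t ht).2 k k'⟩

theorem gramPolar_eq_zero_of_mem_tangentSpaceAt_setCPlus (hp₁ : 0 < p₁) (hp₂ : 0 < p₂) {X}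
    {A B : Fin r → Matrix (Fin p₁) (Fin p₂) ℝ}
    (h : vecCols A * (vecCols B)ᵀ + vecCols B * (vecCols A)ᵀ ∈
      tangentSpaceAt (setCPlus p₁ p₂ r) X) : gramPolar A B = 0 := by
  obtain ⟨h₁, h₂⟩ := partial_traces_of_mem_tangentSpaceAt_setCPlus hp₁ hp₂ h
  ext j j'
  · exact (gramPolar_fst_apply A B j j').trans (h₁ j j')
  · exact (gramPolar_snd_apply A B j j').trans (h₂ j j')

/-- The differential of `X ↦ X Xᵀ` maps tangent vectors of `C` to tangent vectors of `C⁺`. -/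
theorem mul_transpose_add_mem_tangentSpaceAt_setCPlus {X B : Matrix (Fin p₂ × Fin p₁) (Fin r) ℝ}
    (hB : B ∈ tangentSpaceAt (setC p₁ p₂ r) X) :
    X * Bᵀ + B * Xᵀ ∈ tangentSpaceAt (setCPlus p₁ p₂ r) (X * Xᵀ) := by
  obtain ⟨ε, hε, γ, hsm, hmem, rfl, hder⟩ := hB
  refine ⟨ε, hε, fun t => γ t * (γ t)ᵀ, fun j k => ?_, fun t ht => ⟨_, hmem t ht, rfl⟩, rfl,
    fun j k => ?_⟩
  · simp only [Matrix.mul_apply, transpose_apply]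
    exact ContDiffOn.sum fun i _ => (hsm j i).mul (hsm k i)
  · simp only [Matrix.add_apply, Matrix.mul_apply, transpose_apply]
    rw [add_comm, ← Finset.sum_add_distrib]
    exact HasDerivAt.fun_sum fun i _ => (hder j i).mul (hder k i)

open scoped Matrix.Norms.Elementwise in
theorem vecCols_mem_tangentSpaceAt_setC (hp₁ : 0 < p₁) (hp₂ : 0 < p₂) (hr : r ≤ p₁ * p₂)
    {A B : Fin r → Matrix (Fin p₁) (Fin p₂) ℝ} (hA : A ∈ setD p₁ p₂ r) (hB : gramPolar A B = 0) :
    vecCols B ∈ tangentSpaceAt (setC p₁ p₂ r) (vecCols A) := by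
  obtain ⟨γ, hγ, rfl, hder, hmem⟩ := exists_curve_setD hp₁ hp₂ hr hA hB
  -- Regularity `ω` at a point spreads to a neighbourhood, whereas `ContDiffAt ℝ ∞` need not; hence
  -- `ω` in the curve lemmas.
  have hev : ∀ᶠ t in 𝓝 (0 : ℝ), ContDiffAt ℝ ω γ t ∧ γ t ∈ setD p₁ p₂ r :=
    (hγ.eventually (by simp)).and hmem
  obtain ⟨ε, hε, hball⟩ := Metric.eventually_nhds_iff_ball.1 hev
  rw [Real.ball_eq_Ioo, zero_sub, zero_add] at hball
  refine ⟨ε, hε, fun t => vecCols (γ t), fun s i t ht => ?_,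
    fun t ht => ⟨_, (hball t ht).2, rfl⟩, rfl, fun s i => ?_⟩
  · have h₁ : ContDiffAt ℝ ω (fun t => γ t i s.2 s.1) t :=
      contDiffAt_pi.1 (contDiffAt_pi.1 (contDiffAt_pi.1 (hball t ht).1 i) s.2) s.1
    exact (h₁.of_le le_top).contDiffWithinAt
  · exact hasDerivAt_pi.1 (hasDerivAt_pi.1 (hasDerivAt_pi.1 hder i) s.2) s.1

/-- Tangent vectors of `C⁺` come from solutions of the linearized Gram equations. -/
theorem exists_of_mem_tangentSpaceAt_setCPlus (hp₁ : 0 < p₁) (hp₂ : 0 < p₂) (hr : r ≤ p₁ * p₂)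
    {A : Fin r → Matrix (Fin p₁) (Fin p₂) ℝ} (hA : A ∈ setD p₁ p₂ r) {W}
    (hW : W ∈ tangentSpaceAt (setCPlus p₁ p₂ r) (vecCols A * (vecCols A)ᵀ)) :
    ∃ B, gramPolar A B = 0 ∧ W = vecCols A * (vecCols B)ᵀ + vecCols B * (vecCols A)ᵀ := by
  have hrank := (rank_vecCols_iff_det_ne_zero hr A).1 ((mem_setD_iff hp₁ hp₂).1 hA).1
  suffices h : ∃ B, W = vecCols A * Bᵀ + B * (vecCols A)ᵀ by
    obtain ⟨B, rfl⟩ := h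
    obtain ⟨B, rfl⟩ := vecCols_surjective B
    exact ⟨B, gramPolar_eq_zero_of_mem_tangentSpaceAt_setCPlus hp₁ hp₂ hW, rfl⟩
  obtain ⟨ε, hε, γ, -, hmem, hγ0, hder⟩ := hW
  have hnhds : ∀ᶠ t in 𝓝 (0 : ℝ), t ∈ Set.Ioo (-ε) ε := Ioo_mem_nhds (neg_lt_zero.2 hε) hε
  refine IsSymm.exists_eq_mul_transpose_add hrank (IsSymm.ext fun s s' => ?_) fun v hv => ?_
  · refine (hder s' s).unique ((hder s s').congr_of_eventuallyEq ?_)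
    filter_upwards [hnhds] with t ht
    obtain ⟨X, -, hX⟩ := hmem t ht
    rw [← hX]
    simp [Matrix.mul_apply, mul_comm]
  · have hd : HasDerivAt (fun t => v ⬝ᵥ γ t *ᵥ v) (v ⬝ᵥ W *ᵥ v) 0 := by
      simp only [mulVec, dotProduct]
      exact HasDerivAt.fun_sum fun s _ => (HasDerivAt.fun_sum fun s' _ =>
        (hder s s').mul_const (v s')).const_mul (v s)
    -- For `v` in `ker Xᵀ` the form vanishes at `t = 0` and is a sum of squares for nearby `t`.
    refine IsLocalMin.hasDerivAt_eq_zero ?_ hd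
    filter_upwards [hnhds] with t ht
    obtain ⟨X, -, hX⟩ := hmem t ht
    have h0 : v ⬝ᵥ γ 0 *ᵥ v = 0 := by
      rw [hγ0, ← mulVec_mulVec, hv, mulVec_zero, dotProduct_zero]
    have ht : v ⬝ᵥ γ t *ᵥ v = (Xᵀ *ᵥ v) ⬝ᵥ (Xᵀ *ᵥ v) := by
      rw [← hX, ← mulVec_mulVec, dotProduct_mulVec, mulVec_transpose]
    rw [h0, ht]
    exact Finset.sum_nonneg fun i _ => mul_self_nonneg _

end CoreCov

theorem proposition4p2 (p₁ p₂ r : ℕ)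
    (hr : (p₁ : ℝ) / (p₂ : ℝ) + (p₂ : ℝ) / (p₁ : ℝ) < (r : ℝ)) (hrp : r ≤ p₁ * p₂)
    (A : Fin r → Matrix (Fin p₁) (Fin p₂) ℝ) (hA : A ∈ CoreCov.setD p₁ p₂ r) :
    CoreCov.tangentSpaceAt (CoreCov.setC p₁ p₂ r) (CoreCov.vecCols A) =
      {B | Matrix.vec B ∈ LinearMap.ker (Matrix.mulVecLin (CoreCov.J A))} ∧
    CoreCov.tangentSpaceAt (CoreCov.setCPlus p₁ p₂ r)
        (CoreCov.vecCols A * (CoreCov.vecCols A)ᵀ) =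
      {W | ∃ B ∈ CoreCov.tangentSpaceAt (CoreCov.setC p₁ p₂ r) (CoreCov.vecCols A),
        W = CoreCov.vecCols A * Bᵀ + B * (CoreCov.vecCols A)ᵀ} := by
  have hr0 : 0 < r := by
    have : (0 : ℝ) < r := lt_of_le_of_lt (by positivity) hr
    exact_mod_cast this
  have hp₁ : 0 < p₁ := Nat.pos_of_mul_pos_right (hr0.trans_le hrp)
  have hp₂ : 0 < p₂ := Nat.pos_of_mul_pos_left (hr0.trans_le hrp)
  constructor
  · ext B
    obtain ⟨B, rfl⟩ := CoreCov.vecCols_surjective B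
    rw [Set.mem_ofPred_eq, CoreCov.vec_vecCols_mem_ker_J_iff hp₁ hp₂]
    -- The linearized equations for `C` are read off after pushing the tangent vector to `C⁺`.
    exact ⟨fun h => CoreCov.gramPolar_eq_zero_of_mem_tangentSpaceAt_setCPlus hp₁ hp₂
      (CoreCov.mul_transpose_add_mem_tangentSpaceAt_setCPlus h),
      CoreCov.vecCols_mem_tangentSpaceAt_setC hp₁ hp₂ hrp hA⟩
  · ext W
    constructor
    · intro hW
      obtain ⟨B, hB, rfl⟩ := CoreCov.exists_of_mem_tangentSpaceAt_setCPlus hp₁ hp₂ hrp hA hW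
      exact ⟨_, CoreCov.vecCols_mem_tangentSpaceAt_setC hp₁ hp₂ hrp hA hB, rfl⟩
    · rintro ⟨B, hB, rfl⟩
      exact CoreCov.mul_transpose_add_mem_tangentSpaceAt_setCPlus hB
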